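/- Let $R$ be a commutative artinian ring and $\Lambda$ an Artin $R$-algebra, i.e. an $R$-algebra that is finitely generated as an $R$-module; let $\iota: R/\mathrm{rad}(R)\to k$ be an injective envelope. Write $D=\mathrm{Hom}_R(-,k)$ and $\nu(P)=D(\mathrm{Hom}_\Lambda(P,\Lambda))$ for $P$ a finitely generated projective left $\Lambda$-module. Let $n\ge 1$, let $M$ be a finitely generated left $\Lambda$-module with minimal projective resolution $$\cdots\to P^{-n}(M)\xrightarrow{\pi^{-n}_M}\cdots\to P^{-1}(M)\xrightarrow{\pi^{-1}_M}P^0(M)\xrightarrow{\pi^0_M}M\to 0$$ by finitely generated projectives, and put $\Omega^0(M)=M$ and $\Omega^{i}(M)=\mathrm{Ker}(\pi_M^{-i+1})$ for $i\ge 1$. For a finitely generated module $N$ put $\tau(N)=\mathrm{Ker}(\nu(\pi^{-1}_N))$, where $\pi_N^{-1}:P^{-1}(N)\to P^0(N)$ is the first differential of a minimal projective resolution of $N$, and put $\tau_n(M)=\tau(\Omega^{n-1}(M))$. For a module $A$, let $\mathrm{add}(A)$ be the class of direct summands of finite direct sums of copies of $A$. Suppose that $M$ is $\tau_n$-rigid,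 that is, $\mathrm{Hom}_\Lambda(M,\tau_n(M))=0$ and $\mathrm{Ext}^i_\Lambda(M,M)=0$ for all $1\le i\le n-1$. Then $\mathrm{add}(P^0(M))\cap\mathrm{add}(P^{-n}(M))=0$, i.e. the modules lying in both classes are exactly the zero modules. In particular, no indecomposable module is a direct summand of both $P^0(M)$ and $P^{-n}(M)$. -/

import Mathlib

open CategoryTheory

universe u v

noncomputable section

namespace TauRigid

/-! ### Superfluous submodules, injective envelopes, summands, `add` -/

/-- A submodule `S` of `P` is superfluous (small) if `S + N = P` forces `N = P`. -/
def IsSuperfluous {Λ : Type*} [Ring Λ] {P : Type*} [AddCommGroup P] [Module Λ P]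
    (S : Submodule Λ P) : Prop :=
  ∀ N : Submodule Λ P, S ⊔ N = ⊤ → N = ⊤

/-- `ι : N → E` is an injective envelope: `E` is an injective module, `ι` is a monomorphism and
its image is an essential submodule of `E`. -/
structure IsInjectiveEnvelope {R : Type u} [Ring R] {N E : Type u} [AddCommGroup N] [Module R N]
    [AddCommGroup E] [Module R E] (ι : N →ₗ[R] E) : Prop where
  injective_module : Module.Injective R E
  injective : Function.Injective ι
  essential : ∀ S : Submodule R E, S ⊓ LinearMap.range ι = ⊥ → S = ⊥

/-- `X` is (isomorphic to) a direct summand of `A`. -/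
def IsSummand (Λ : Type*) [Ring Λ] (A X : Type*) [AddCommGroup A] [Module Λ A]
    [AddCommGroup X] [Module Λ X] : Prop :=
  ∃ (i : X →ₗ[Λ] A) (r : A →ₗ[Λ] X), r ∘ₗ i = LinearMap.id

/-- `X ∈ add(A)`: `X` is a direct summand of a finite direct sum of copies of `A`. -/
def InAdd (Λ : Type*) [Ring Λ] (A X : Type*) [AddCommGroup A] [Module Λ A]
    [AddCommGroup X] [Module Λ X] : Prop :=
  ∃ m : ℕ, IsSummand Λ (Fin m → A) X

/-! ### The duality `D = Hom_R(-, k)` from right to left modules, and the Nakayama functor -/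

section Duality

variable (R : Type u) [CommRing R] (Λ : Type v) [Ring Λ] [Algebra R Λ]
variable (k : Type u) [AddCommGroup k] [Module R k]

/-- The dual `D(N) = Hom_R(N, k)` of a right `Λ`-module `N`; it is a left `Λ`-module by
`(a • g)(y) = g(y a)`. -/
def RightDual (_Λ : Type v) (N : Type v) [AddCommGroup N] [Module R N] : Type (max u v) :=
  N →ₗ[R] k

namespace RightDual

variable (N : Type v) [AddCommGroup N] [Module R N]

instance : AddCommGroup (RightDual R k Λ N) :=
  inferInstanceAs (AddCommGroup (N →ₗ[R] k))

variable [Module Λᵐᵒᵖ N] [SMulCommClass R Λᵐᵒᵖ N]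

/-- Right multiplication by `a` on a right `Λ`-module, as an `R`-linear map. -/
def rmul (a : Λ) : N →ₗ[R] N where
  toFun y := MulOpposite.op a • y
  map_add' y z := smul_add _ y z
  map_smul' r y := (smul_comm r (MulOpposite.op a) y).symm

instance : Module Λ (RightDual R k Λ N) where
  smul a g := LinearMap.comp (show N →ₗ[R] k from g) (rmul R Λ N a)
  one_smul g := LinearMap.ext fun y => congrArg (show N →ₗ[R] k from g) (one_smul Λᵐᵒᵖ y)
  mul_smul a b g := LinearMap.ext fun y => congrArg (show N →ₗ[R] k from g)
    (mul_smul (MulOpposite.op b) (MulOpposite.op a) y)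
  smul_zero _ := LinearMap.ext fun _ => rfl
  smul_add _ _ _ := LinearMap.ext fun _ => rfl
  add_smul a b g := LinearMap.ext fun y =>
    (congrArg (show N →ₗ[R] k from g)
      (add_smul (MulOpposite.op a) (MulOpposite.op b) y)).trans
      (map_add (show N →ₗ[R] k from g) _ _)
  zero_smul g := LinearMap.ext fun y =>
    (congrArg (show N →ₗ[R] k from g) (zero_smul Λᵐᵒᵖ y)).trans
      (map_zero (show N →ₗ[R] k from g))

end RightDual

/-- `ν(P) = D(P^*)`, where `P^* = Hom_Λ(P, Λ)` is a right `Λ`-module by `(φ a)(x) = φ(x) a`. -/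
abbrev Nakayama (P : Type v) [AddCommGroup P] [Module Λ P] : Type (max u v) :=
  RightDual R k Λ (P →ₗ[Λ] Λ)

variable {Λ}
variable {P Q : Type v} [AddCommGroup P] [Module Λ P] [AddCommGroup Q] [Module Λ Q]

/-- `f^* : Q^* → P^*`, `φ ↦ φ ∘ f`, for `f : P → Q`. -/
def starMap (f : P →ₗ[Λ] Q) : (Q →ₗ[Λ] Λ) →ₗ[R] (P →ₗ[Λ] Λ) where
  toFun φ := φ ∘ₗ f
  map_add' _ _ := rfl
  map_smul' _ _ := rfl

/-- `ν(f) = D(f^*) : ν(P) → ν(Q)`, `g ↦ g ∘ f^*`, for `f : P → Q`. -/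
def nakayamaMap (f : P →ₗ[Λ] Q) : Nakayama R Λ k P →ₗ[Λ] Nakayama R Λ k Q where
  toFun g := LinearMap.comp (show (P →ₗ[Λ] Λ) →ₗ[R] k from g) (starMap R f)
  map_add' _ _ := rfl
  map_smul' _ _ := rfl

end Duality

/-! ### Minimal projective resolutions, syzygies, the translations `τ` and `τ_n` -/

section Resolution

variable {Λ : Type v} [Ring Λ] {M : ModuleCat.{v} Λ}

/-- The projective resolution `⋯ → P_1 → P_0 → M → 0` is a minimal projective resolution in
the category of finitely generated modules: all terms are finitely generated and each map
`P_i → Im` is a projective cover, that is, has superfluous kernel.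
The term written `P^{-i}(M)` in cohomological notation is `P.complex.X i`. -/
structure IsMinimal (P : ProjectiveResolution M) : Prop where
  finite : ∀ i, Module.Finite Λ (P.complex.X i)
  superfluous_zero : IsSuperfluous (LinearMap.ker (P.π.f 0).hom)
  superfluous_succ : ∀ i, IsSuperfluous (LinearMap.ker (P.complex.d (i + 1) i).hom)

/-- The `i`-th syzygy `Ω^i(M)` computed in the resolution `P` of `M`:
`Ω^0(M) = M`, `Ω^1(M) = Ker(P_0 → M)` and `Ω^{i+2}(M) = Ker(P_{i+1} → P_i)`. -/
def syzygy (P : ProjectiveResolution M) : ℕ → ModuleCat.{v} Λ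
  | 0 => M
  | 1 => ModuleCat.of Λ (LinearMap.ker (P.π.f 0).hom)
  | i + 2 => ModuleCat.of Λ (LinearMap.ker (P.complex.d (i + 1) i).hom)

variable (R : Type u) [CommRing R] [Algebra R Λ] (k : Type u) [AddCommGroup k] [Module R k]

/-- The Auslander-Reiten translation `τ(N) = Ker(ν(Q_1 → Q_0))`, where `Q` is the (minimal)
projective resolution of `N`. -/
abbrev tau {N : ModuleCat.{v} Λ} (Q : ProjectiveResolution N) :
    Submodule Λ (Nakayama R Λ k (Q.complex.X 1)) :=
  LinearMap.ker (nakayamaMap R k (Q.complex.d 1 0).hom)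

/-- `N` lies in the `τ_n`-perpendicular category of `M`: `Hom_Λ(N, τ_n(M)) = 0` and
`Ext^i_Λ(M, N) = 0` for `1 ≤ i ≤ n - 1`. Here `P` and `Q` are the minimal projective resolutions
of `M` and of `Ω^{n-1}(M)`, and `τ_n(M) = τ(Ω^{n-1}(M))`. -/
def InTauPerp (P : ProjectiveResolution M) (n : ℕ) (Q : ProjectiveResolution (syzygy P (n - 1)))
    (N : ModuleCat.{v} Λ) : Prop :=
  (∀ f : N →ₗ[Λ] tau R k Q, f = 0) ∧
    ∀ i : ℕ, 1 ≤ i → i < n → Subsingleton (Abelian.Ext M N i)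

/-- `M` is `τ_n`-rigid: it lies in its own `τ_n`-perpendicular category. -/
def IsTauRigid (P : ProjectiveResolution M) (n : ℕ)
    (Q : ProjectiveResolution (syzygy P (n - 1))) : Prop :=
  InTauPerp R k P n Q M

end Resolution

end TauRigid

end

namespace TauRigid

/-! ### Superfluous submodules and radicals -/

section Superfluous

variable {Λ : Type*} [Ring Λ] {A B N : Type*} [AddCommGroup A] [Module Λ A]
  [AddCommGroup B] [Module Λ B] [AddCommGroup N] [Module Λ N]

/-! The link is the pairing between `D Hom_Λ(P, M)` and `Hom_Λ(M, ν(P))` for `P` finitely generated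
projective: a functional on the cokernel of `Hom_Λ(Q_0, M) → Hom_Λ(Q_1, M)` gives a map from `M` to
`Ker ν(Q_1 → Q_0) = τ_n(M)`. As `k` cogenerates, `Hom_Λ(M, τ_n(M)) = 0` forces every map `Q_1 → M`
to factor through `Q_1 → Q_0` (`exists_comp_eq_of_hom_ker_nakayamaMap_eq_zero`). By minimality the
latter has image in `rad Q_0`, so every map `P^{-n}(M) → M` has image in `rad M`.

If `X` lies in both add-classes, each map `X → P^0(M) → M` therefore lands in `rad M`. The kernel of
`P^0(M) → M` lies in the radical, so `X → P^0(M)` already lands in `rad P^0(M)`. Splitting gives `X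
= rad X`, and `X = 0` by Nakayama's lemma. -/

theorem IsSuperfluous.le_jacobson {S : Submodule Λ A} (hS : IsSuperfluous S) :
    S ≤ Module.jacobson Λ A := by
  refine le_sInf fun m hm => ?_
  by_contra h
  refine hm.1 (hS m (hm.2 _ (lt_of_le_of_ne le_sup_right fun he => h ?_)))
  exact he ▸ le_sup_left

/-- A map into `A` that becomes surjective modulo a superfluous kernel is surjective. -/
theorem IsSuperfluous.surjective_of_comp {p : A →ₗ[Λ] N} (hp : IsSuperfluous (LinearMap.ker p))
    {g : B →ₗ[Λ] A} (h : Function.Surjective (p ∘ₗ g)) : Function.Surjective g := by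
  rw [← LinearMap.range_eq_top]
  refine hp _ (eq_top_iff.2 fun x _ => ?_)
  obtain ⟨b, hb⟩ := h (p x)
  refine Submodule.mem_sup.2 ⟨x - g b, ?_, g b, ⟨b, rfl⟩, sub_add_cancel _ _⟩
  rw [LinearMap.mem_ker, map_sub, sub_eq_zero]
  exact hb.symm

theorem IsSuperfluous.ker_codRestrict {f : A →ₗ[Λ] B} (hf : IsSuperfluous (LinearMap.ker f))
    {S : Submodule Λ B} (h : ∀ x, f x ∈ S) :
    IsSuperfluous (LinearMap.ker (f.codRestrict S h)) := by
  rwa [LinearMap.ker_codRestrict]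

/-- Reduces arguments about summands of powers to single copies of `A`; for `A = Λ` it is the dual
basis expansion. -/
theorem eq_sum_single_of_comp_eq_id {m : ℕ} {i : B →ₗ[Λ] Fin m → A} {r : (Fin m → A) →ₗ[Λ] B}
    (h : r ∘ₗ i = LinearMap.id) (x : B) :
    x = ∑ c, r (LinearMap.single Λ (fun _ => A) c (i x c)) := by
  rw [← map_sum]
  exact (LinearMap.congr_fun h x).symm.trans
    (congrArg r (Finset.univ_sum_single (i x)).symm)

theorem InAdd.finite {X : Type*} [AddCommGroup X] [Module Λ X] [Module.Finite Λ A]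
    (h : InAdd Λ A X) : Module.Finite Λ X := by
  obtain ⟨m, i, r, hr⟩ := h
  exact Module.Finite.of_surjective r fun x => ⟨i x, LinearMap.congr_fun hr x⟩

/-- If every map from `B` to the quotient `N` of `A` by a superfluous submodule has image in the
radical, then `add A ∩ add B = 0`. -/
theorem subsingleton_of_inAdd_of_range_le_jacobson {X : Type*} [AddCommGroup X] [Module Λ X]
    [Module.Finite Λ A] {p : A →ₗ[Λ] N} (hp : Function.Surjective p)
    (hker : IsSuperfluous (LinearMap.ker p))
    (hB : ∀ f : B →ₗ[Λ] N, LinearMap.range f ≤ Module.jacobson Λ N)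
    (hXA : InAdd Λ A X) (hXB : InAdd Λ B X) : Subsingleton X := by
  have := hXA.finite
  obtain ⟨a, i, r, hri⟩ := hXA
  obtain ⟨b, j, s, hsj⟩ := hXB
  by_contra hX
  rw [not_subsingleton_iff_nontrivial] at hX
  have key (c : Fin a) (x : X) : i x c ∈ Module.jacobson Λ A := by
    -- `rad A` is the preimage of `rad N`, because the kernel of `p` lies in `rad A`.
    rw [← Module.comap_jacobson_of_ker_le hp hker.le_jacobson, Submodule.mem_comap]
    rw [eq_sum_single_of_comp_eq_id hsj x, map_sum, Finset.sum_apply, map_sum]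
    exact Submodule.sum_mem _ fun d _ =>
      hB (p ∘ₗ LinearMap.proj c ∘ₗ i ∘ₗ s ∘ₗ LinearMap.single Λ (fun _ => B) d) ⟨j x d, rfl⟩
  -- The radical of a nonzero finitely generated module is proper, so `X = rad X` is the
  -- contradiction sought.
  refine (Module.jacobson_lt_top Λ X).ne (eq_top_iff.2 fun x _ => ?_)
  rw [eq_sum_single_of_comp_eq_id hri x]
  exact Submodule.sum_mem _ fun c _ =>
    Module.le_comap_jacobson (r ∘ₗ LinearMap.single Λ (fun _ => A) c) (key c x)

end Superfluous

/-! ### The injective envelope of `R / rad R` is a cogenerator -/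

section Cogenerator

variable {R : Type u} [CommRing R] [IsArtinianRing R]

/-- In an artinian ring every maximal ideal is the annihilator of an element of `R / rad R`. -/
theorem exists_mem_iff_mul_mem_jacobson (m : Ideal R) [hm : m.IsMaximal] :
    ∃ x : R, ∀ r : R, r * x ∈ Ring.jacobson R ↔ r ∈ m := by
  classical
  have hfin : {I : Ideal R | I.IsMaximal}.Finite := IsArtinianRing.setOfPred_isMaximal_finite R
  -- A prime containing a finite intersection contains one of the ideals; hence some `x` outside `m`
  -- lies in all other maximal ideals.
  have hle : ¬ (hfin.toFinset.erase m).inf id ≤ m := by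
    rw [hm.isPrime.inf_le']
    rintro ⟨I, hI, hIm⟩
    simp only [Finset.mem_erase, Set.Finite.mem_toFinset, Set.mem_ofPred_eq] at hI
    exact hI.1 (hI.2.eq_of_le hm.ne_top hIm)
  obtain ⟨x, hx, hxm⟩ := SetLike.not_le_iff_exists.1 hle
  refine ⟨x, fun r => ⟨fun h => ?_, fun h => ?_⟩⟩
  · exact (hm.isPrime.mem_or_mem (Ring.jacobson_le_of_isMaximal m h)).resolve_right hxm
  · rw [Ring.jacobson_eq_sInf_isMaximal, Submodule.mem_sInf]
    intro I hI
    by_cases hIm : I = m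
    · exact hIm ▸ m.mul_mem_right x h
    · refine Ideal.mul_mem_left (I : Ideal R) r ?_
      exact (Submodule.mem_finsetInf.1 hx) I (by simpa [hIm] using hI)

/-- The injective envelope of `R / rad R` separates the elements of every `R`-module. -/
theorem IsInjectiveEnvelope.exists_apply_ne_zero {k : Type u} [AddCommGroup k] [Module R k]
    {ι : (R ⧸ Ring.jacobson R) →ₗ[R] k} (hk : IsInjectiveEnvelope ι)
    {C : Type*} [AddCommGroup C] [Module R C] {c : C} (hc : c ≠ 0) :
    ∃ φ : C →ₗ[R] k, φ c ≠ 0 := by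
  have hne : LinearMap.ker (LinearMap.toSpanSingleton R C c) ≠ ⊤ := fun h => hc <| by
    have : (1 : R) ∈ LinearMap.ker (LinearMap.toSpanSingleton R C c) := h ▸ Submodule.mem_top
    simpa using this
  obtain ⟨m, hm, hle⟩ := Ideal.exists_le_maximal _ hne
  obtain ⟨x, hx⟩ := exists_mem_iff_mul_mem_jacobson m
  let g : R →ₗ[R] k := ι ∘ₗ LinearMap.toSpanSingleton R _ (Submodule.Quotient.mk x)
  have hg (r : R) : g r = 0 ↔ r ∈ m := by
    rw [← hx, ← smul_eq_mul, ← Submodule.Quotient.mk_eq_zero, Submodule.Quotient.mk_smul]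
    exact map_eq_zero_iff ι hk.injective
  -- `g` has kernel `m ⊇ Ann(c)`, so it descends to `R / Ann(c) ≅ Rc` and extends to `C`; then `φ c
  -- = g 1 ≠ 0`.
  obtain ⟨φ, hφ⟩ := (Module.Baer.of_injective hk.injective_module).extension_property
    ((LinearMap.ker (LinearMap.toSpanSingleton R C c)).liftQ
      (LinearMap.toSpanSingleton R C c) le_rfl)
    (LinearMap.ker_eq_bot.1 (Submodule.ker_liftQ_eq_bot _ _ _ le_rfl))
    ((LinearMap.ker (LinearMap.toSpanSingleton R C c)).liftQ g fun r hr => (hg r).2 (hle hr))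
  refine ⟨φ, fun h => hm.ne_top ((Ideal.eq_top_iff_one m).2 ((hg 1).1 ?_))⟩
  refine (LinearMap.congr_fun hφ (Submodule.Quotient.mk 1)).symm.trans ?_
  change φ ((1 : R) • c) = 0
  rw [one_smul, h]

end Cogenerator

/-! ### Maps into the kernel of `ν(d)` -/

section Nakayama

variable {R : Type u} [CommRing R] {Λ : Type v} [Ring Λ] [Algebra R Λ]
  {k : Type u} [AddCommGroup k] [Module R k]
  {P Q M : Type v} [AddCommGroup P] [Module Λ P] [AddCommGroup Q] [Module Λ Q]
  [AddCommGroup M] [Module Λ M] [Module R M] [IsScalarTower R Λ M]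

/-- The map `M → ν(P)`, `m ↦ (ψ ↦ φ(ψ(-) m))`, attached to `φ ∈ D Hom_Λ(P, M)`. -/
def toNakayama (φ : (P →ₗ[Λ] M) →ₗ[R] k) : M →ₗ[Λ] Nakayama R Λ k P where
  toFun m := show (P →ₗ[Λ] Λ) →ₗ[R] k from
    { toFun := fun ψ => φ (LinearMap.toSpanSingleton Λ M m ∘ₗ ψ)
      map_add' := fun ψ χ => by rw [LinearMap.comp_add, map_add]
      map_smul' := fun r ψ => by
        rw [RingHom.id_apply, ← map_smul]
        congr 1
        ext x
        simp }
  map_add' m m' := LinearMap.ext fun ψ => by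
    refine Eq.trans ?_ (map_add φ _ _)
    refine congrArg φ (LinearMap.ext fun x => ?_)
    simp
  map_smul' a m := LinearMap.ext fun ψ => by
    refine congrArg φ (LinearMap.ext fun x => ?_)
    change ψ x • a • m = (ψ x * a) • m
    rw [mul_smul]

/-- If `Hom_Λ(M, Ker ν(d)) = 0`, every map `P → M` factors through `d : P → Q`. -/
theorem exists_comp_eq_of_hom_ker_nakayamaMap_eq_zero [IsArtinianRing R]
    {ι : (R ⧸ Ring.jacobson R) →ₗ[R] k} (hk : IsInjectiveEnvelope ι)
    [Module.Finite Λ P] [Module.Projective Λ P] (d : P →ₗ[Λ] Q)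
    (h : ∀ F : M →ₗ[Λ] LinearMap.ker (nakayamaMap R k d), F = 0) (f : P →ₗ[Λ] M) :
    ∃ g : Q →ₗ[Λ] M, g ∘ₗ d = f := by
  let dM : (Q →ₗ[Λ] M) →ₗ[R] (P →ₗ[Λ] M) :=
    { toFun := fun g => g ∘ₗ d
      map_add' := fun _ _ => rfl
      map_smul' := fun _ _ => rfl }
  by_contra hf
  have hne : (LinearMap.range dM).mkQ f ≠ 0 := fun h0 =>
    hf ((Submodule.Quotient.mk_eq_zero _).1 h0)
  obtain ⟨φ, hφ⟩ := hk.exists_apply_ne_zero hne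
  refine hφ ?_
  let φ' := φ ∘ₗ (LinearMap.range dM).mkQ
  have hd (g : Q →ₗ[Λ] M) : φ' (g ∘ₗ d) = 0 := by
    have : (LinearMap.range dM).mkQ (g ∘ₗ d) = 0 :=
      (Submodule.Quotient.mk_eq_zero _).2 ⟨g, rfl⟩
    rw [LinearMap.comp_apply, this, map_zero]
  have hmem (m : M) : toNakayama φ' m ∈ LinearMap.ker (nakayamaMap R k d) :=
    LinearMap.mem_ker.2 (LinearMap.ext fun ψ =>
      hd (LinearMap.toSpanSingleton Λ M m ∘ₗ ψ))
  have hzero (m : M) (ψ : P →ₗ[Λ] Λ) : φ' (LinearMap.toSpanSingleton Λ M m ∘ₗ ψ) = 0 := by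
    have h1 := congrArg Subtype.val (LinearMap.congr_fun (h ((toNakayama φ').codRestrict _ hmem)) m)
    exact DFunLike.congr_fun (F := (P →ₗ[Λ] Λ) →ₗ[R] k) h1 ψ
  -- The maps `P → Λ → M`, all killed by `φ'`, span `Hom_Λ(P, M)` by a dual basis of `P`.
  obtain ⟨n, p, q, -, -, hpq⟩ := Module.Finite.exists_comp_eq_id_of_projective Λ P
  have hsum : f = ∑ c, LinearMap.toSpanSingleton Λ M (f (p (Pi.single c 1))) ∘ₗ
      (LinearMap.proj c ∘ₗ q) := by
    ext x
    conv_lhs => rw [eq_sum_single_of_comp_eq_id hpq x]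
    rw [map_sum, LinearMap.sum_apply]
    refine Finset.sum_congr rfl fun c _ => ?_
    have : LinearMap.single Λ (fun _ => Λ) c (q x c) = q x c • Pi.single c 1 := by
      rw [← Pi.single_smul, smul_eq_mul, mul_one, LinearMap.single_apply]
    rw [this, map_smul, map_smul]
    rfl
  change φ' f = 0
  rw [hsum, map_sum]
  exact Finset.sum_eq_zero fun c _ => hzero _ _

end Nakayama

/-! ### Minimal projective resolutions -/

section Resolution

variable {Λ : Type v} [Ring Λ] {M : ModuleCat.{v} Λ}

theorem ker_d_eq_range (P : ProjectiveResolution M) (i : ℕ) :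
    LinearMap.range (P.complex.d (i + 2) (i + 1)).hom =
      LinearMap.ker (P.complex.d (i + 1) i).hom :=
  (P.exact_succ i).moduleCat_range_eq_ker

theorem ker_π_eq_range (P : ProjectiveResolution M) :
    LinearMap.range (P.complex.d 1 0).hom = LinearMap.ker (P.π.f 0).hom :=
  P.exact₀.moduleCat_range_eq_ker

theorem π_surjective (P : ProjectiveResolution M) : Function.Surjective (P.π.f 0).hom :=
  (ModuleCat.epi_iff_surjective _).1 inferInstance

/-- In a minimal resolution, each term is a projective cover of the corresponding syzygy. -/
theorem IsMinimal.exists_cover {P : ProjectiveResolution M} (hP : IsMinimal P) (i : ℕ) :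
    ∃ e : P.complex.X i →ₗ[Λ] syzygy P i, Function.Surjective e ∧
      LinearMap.range (P.complex.d (i + 1) i).hom = LinearMap.ker e ∧
      IsSuperfluous (LinearMap.ker e) := by
  match i with
  | 0 => exact ⟨(P.π.f 0).hom, π_surjective P, ker_π_eq_range P, hP.superfluous_zero⟩
  | 1 =>
    have hmem (x : P.complex.X 1) :
        (P.complex.d 1 0).hom x ∈ LinearMap.ker (P.π.f 0).hom :=
      ker_π_eq_range P ▸ LinearMap.mem_range_self _ x
    refine ⟨(P.complex.d 1 0).hom.codRestrict _ hmem, ?_, ?_, ?_⟩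
    · rintro ⟨y, hy⟩
      rw [← ker_π_eq_range P] at hy
      obtain ⟨x, hx⟩ := hy
      exact ⟨x, Subtype.ext hx⟩
    · exact (ker_d_eq_range P 0).trans (LinearMap.ker_codRestrict _ _ _).symm
    · exact (hP.superfluous_succ 0).ker_codRestrict hmem
  | i + 2 =>
    have hmem (x : P.complex.X (i + 2)) :
        (P.complex.d (i + 2) (i + 1)).hom x ∈ LinearMap.ker (P.complex.d (i + 1) i).hom :=
      ker_d_eq_range P i ▸ LinearMap.mem_range_self _ x
    refine ⟨(P.complex.d (i + 2) (i + 1)).hom.codRestrict _ hmem, ?_, ?_, ?_⟩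
    · rintro ⟨y, hy⟩
      rw [← ker_d_eq_range P i] at hy
      obtain ⟨x, hx⟩ := hy
      exact ⟨x, Subtype.ext hx⟩
    · exact (ker_d_eq_range P (i + 1)).trans (LinearMap.ker_codRestrict _ _ _).symm
    · exact (hP.superfluous_succ (i + 1)).ker_codRestrict hmem

/-- The first term of a projective resolution of a syzygy maps onto the corresponding term of the
minimal resolution. -/
theorem IsMinimal.exists_surjective {P : ProjectiveResolution M} (hP : IsMinimal P) (i : ℕ)
    (Q : ProjectiveResolution (syzygy P i)) :
    ∃ g : Q.complex.X 1 →ₗ[Λ] P.complex.X (i + 1), Function.Surjective g := by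
  obtain ⟨e, he, hrange, hker⟩ := hP.exists_cover i
  let q : Q.complex.X 0 →ₗ[Λ] syzygy P i := (Q.π.f 0).hom
  have hq : Function.Surjective q := π_surjective Q
  -- Lift the identity of the syzygy to `g₀`, restrict to the kernels of the covers, and lift once
  -- more; superfluity makes both lifts onto.
  obtain ⟨g₀, hg₀⟩ := Module.projective_lifting_property e q he
  have hg₀s : Function.Surjective g₀ := hker.surjective_of_comp (hg₀ ▸ hq)
  let δ : P.complex.X (i + 1) →ₗ[Λ] LinearMap.ker e :=
    (P.complex.d (i + 1) i).hom.codRestrict _ fun x => hrange ▸ LinearMap.mem_range_self _ x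
  have hδ : Function.Surjective δ := by
    rintro ⟨y, hy⟩
    rw [← hrange] at hy
    obtain ⟨x, hx⟩ := hy
    exact ⟨x, Subtype.ext hx⟩
  have hδker : IsSuperfluous (LinearMap.ker δ) := (hP.superfluous_succ i).ker_codRestrict _
  have hmem (x : Q.complex.X 1) : g₀ ((Q.complex.d 1 0).hom x) ∈ LinearMap.ker e := by
    have hx : (Q.complex.d 1 0).hom x ∈ LinearMap.ker q :=
      (ker_π_eq_range Q).le (LinearMap.mem_range_self _ x)
    exact (LinearMap.congr_fun hg₀ _).trans hx
  let γ : Q.complex.X 1 →ₗ[Λ] LinearMap.ker e :=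
    (g₀ ∘ₗ (Q.complex.d 1 0).hom).codRestrict _ hmem
  have hγ : Function.Surjective γ := by
    rintro ⟨y, hy⟩
    obtain ⟨x, rfl⟩ := hg₀s y
    have hx : x ∈ LinearMap.ker q := (LinearMap.congr_fun hg₀ x).symm.trans hy
    obtain ⟨z, hz⟩ := (ker_π_eq_range Q).ge hx
    exact ⟨z, Subtype.ext (congrArg g₀ hz)⟩
  obtain ⟨g, hg⟩ := Module.projective_lifting_property δ γ hδ
  exact ⟨g, hδker.surjective_of_comp (hg ▸ hγ)⟩

/-- If `Hom_Λ(N, τ_n(M)) = 0`, the image of every map `P^{-n}(M) → N` lies in the radical. -/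
theorem range_le_jacobson_of_hom_tau_eq_zero {R : Type u} [CommRing R] [IsArtinianRing R]
    [Algebra R Λ] {k : Type u} [AddCommGroup k] [Module R k]
    {ι : (R ⧸ Ring.jacobson R) →ₗ[R] k} (hk : IsInjectiveEnvelope ι)
    {P : ProjectiveResolution M} (hP : IsMinimal P) (i : ℕ)
    {Q : ProjectiveResolution (syzygy P i)} (hQ : IsMinimal Q) {N : ModuleCat.{v} Λ}
    (h : ∀ F : N →ₗ[Λ] tau R k Q, F = 0) (f : P.complex.X (i + 1) →ₗ[Λ] N) :
    LinearMap.range f ≤ Module.jacobson Λ N := by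
  -- `N` becomes an `R`-module through `R → Λ`, so that `Hom_Λ(-, N)` can be dualised.
  let := Module.compHom N (algebraMap R Λ)
  have : IsScalarTower R Λ N := ⟨fun r a x => by rw [Algebra.smul_def, mul_smul]; rfl⟩
  have := hQ.finite 1
  obtain ⟨g, hg⟩ := hP.exists_surjective i Q
  -- Precomposing with the surjection `g` does not change the image of `f`, so `Q_1` may replace
  -- `P^{-n}(M)`.
  obtain ⟨u, hu⟩ := exists_comp_eq_of_hom_ker_nakayamaMap_eq_zero hk _ h (f ∘ₗ g)
  rintro _ ⟨x, rfl⟩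
  obtain ⟨y, rfl⟩ := hg x
  change (f ∘ₗ g) y ∈ _
  rw [← hu]
  refine Module.le_comap_jacobson u (hQ.superfluous_zero.le_jacobson ?_)
  exact (ker_π_eq_range Q).le (LinearMap.mem_range_self _ y)

end Resolution

end TauRigid

theorem mainTheorem10
    {R : Type u} [CommRing R] [IsArtinianRing R]
    {Λ : Type v} [Ring Λ] [Algebra R Λ] [Module.Finite R Λ]
    {k : Type u} [AddCommGroup k] [Module R k]
    (ι : (R ⧸ Ring.jacobson R) →ₗ[R] k) (hk : TauRigid.IsInjectiveEnvelope ι)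
    (n : ℕ) (hn : 1 ≤ n)
    (M : ModuleCat.{v} Λ) [Module.Finite Λ M]
    (P : ProjectiveResolution M) (hP : TauRigid.IsMinimal P)
    (Q : ProjectiveResolution (TauRigid.syzygy P (n - 1))) (hQ : TauRigid.IsMinimal Q)
    (hM : TauRigid.IsTauRigid R k P n Q) :
    (∀ X : ModuleCat.{v} Λ,
      (TauRigid.InAdd Λ (P.complex.X 0) X ∧ TauRigid.InAdd Λ (P.complex.X n) X) ↔
        Subsingleton X) ∧
    ¬ ∃ X : ModuleCat.{v} Λ, Indecomposable X ∧
      TauRigid.IsSummand Λ (P.complex.X 0) X ∧ TauRigid.IsSummand Λ (P.complex.X n) X := by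
  have key (X : ModuleCat.{v} Λ) (h₀ : TauRigid.InAdd Λ (P.complex.X 0) X)
      (hX : TauRigid.InAdd Λ (P.complex.X n) X) : Subsingleton X := by
    obtain ⟨i, rfl⟩ : ∃ i, n = i + 1 := ⟨n - 1, by omega⟩
    have := hP.finite 0
    exact TauRigid.subsingleton_of_inAdd_of_range_le_jacobson (TauRigid.π_surjective P)
      hP.superfluous_zero (TauRigid.range_le_jacobson_of_hom_tau_eq_zero hk hP i hQ hM.1) h₀ hX
  have inAdd_of_isSummand (A X : ModuleCat.{v} Λ) (h : TauRigid.IsSummand Λ A X) :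
      TauRigid.InAdd Λ A X := by
    obtain ⟨i, r, hr⟩ := h
    exact ⟨1, LinearMap.pi fun _ => i, r ∘ₗ LinearMap.proj 0, hr⟩
  refine ⟨fun X => ⟨fun h => key X h.1 h.2, fun h => ?_⟩, ?_⟩
  -- A zero module is a summand of the empty power.
  · exact ⟨⟨0, 0, 0, LinearMap.ext fun _ => Subsingleton.elim _ _⟩,
      ⟨0, 0, 0, LinearMap.ext fun _ => Subsingleton.elim _ _⟩⟩
  · rintro ⟨X, hX, h₀, hn⟩
    have := key X (inAdd_of_isSummand _ X h₀) (inAdd_of_isSummand _ X hn)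
    exact hX.1 (ModuleCat.isZero_of_subsingleton X)
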